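/- Let $m,N,K$ be natural numbers with $N\ge 2$ and $1\le K\le N$, let $D\in\mathbb R^{m\times N}$ have columns of unit Euclidean norm, let $x\in\mathbb R^N$ have at most $K$ non-zero entries, and let $y=Dx+e$, where $e\in\mathbb R^m$ is a white Gaussian noise vector with variance $\sigma^2>0$ (its entries are independent $\mathcal N(0,\sigma^2)$ random variables). Let $\delta_{3K}$ be the restricted isometry constant of order $3K$ of $D$, i.e. the smallest $\delta$ such that $(1-\delta)\|z\|_2^2\le\|Dz\|_2^2\le(1+\delta)\|z\|_2^2$ for every $z$ with at most $3K$ non-zero entries. For a set $S$ of column indices let $D_S$ be the submatrix of $D$ with these columns, $D_S^*$ its transpose and $D_S^\dagger$ its pseudo-inverse. Subspace Pursuit (SP) starts from $T^0=\emptyset$ and in iteration $\ell\ge1$ computes the residual $r=y-D_{T^{\ell-1}}D_{T^{\ell-1}}^\dagger y$, the set $T_\Delta$ of the positions of the $K$ entries of largest magnitude of $D^*r$, the set $\tilde T=T^{\ell-1}\cup T_\Delta$, the vector $x_p=D_{\tilde T}^\dagger y$ indexed by $\tilde T$, and the set $T^\ell\subseteq\tilde T$ of the positions of the $K$ entries of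 largest magnitude of $x_p$ (ties broken arbitrarily). When it is stopped after $\ell$ iterations, its output $\hat x_{SP}$ equals $D_{T^\ell}^\dagger y$ on $T^\ell$ and $0$ elsewhere. Let $a>-1$ and $$C_{SP}=2\cdot\frac{7-9\delta_{3K}+7\delta_{3K}^2-\delta_{3K}^3}{(1-\delta_{3K})^4},\qquad \ell^*=\max\Bigl(0,\Bigl\lceil\log_2\frac{\|x\|_2}{\max_{|T|=K}\|D_T^*e\|_2}\Bigr\rceil\Bigr)$$ (with $\ell^*=0$ if $x=0$). If $\delta_{3K}\le 0.139$, then $C_{SP}\le 21.41$, and with probability exceeding $1-\bigl(\sqrt{\pi(1+a)\log N}\cdot N^a\bigr)^{-1}$ every output $\hat x_{SP}$ of SP stopped after any number $\ell\ge\ell^*$ of iterations satisfies $$\|x-\hat x_{SP}\|_2^2\le C_{SP}^2\cdot 2(1+a)\log N\cdot K\sigma^2 .$$ -/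

import Mathlib

open MeasureTheory ProbabilityTheory

noncomputable section

namespace SubspacePursuit

/-- The image `D x` of a vector, with the Euclidean norm on both sides. -/
def applyMat {m N : ℕ} (D : Matrix (Fin m) (Fin N) ℝ) (x : EuclideanSpace ℝ (Fin N)) :
    EuclideanSpace ℝ (Fin m) :=
  WithLp.toLp 2 (D.mulVec x.ofLp)

/-- The support of a vector. -/
def supp {N : ℕ} (x : EuclideanSpace ℝ (Fin N)) : Finset (Fin N) :=
  Finset.univ.filter fun i => x i ≠ 0

/-- The restricted isometry constant `δ_k` of `D`: the smallest `δ` with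
`(1 - δ)‖z‖² ≤ ‖D z‖² ≤ (1 + δ)‖z‖²` for every `k`-sparse vector `z`. -/
def ripConst {m N : ℕ} (D : Matrix (Fin m) (Fin N) ℝ) (k : ℕ) : ℝ :=
  sInf {δ : ℝ | ∀ z : EuclideanSpace ℝ (Fin N), (supp z).card ≤ k →
    (1 - δ) * ‖z‖ ^ 2 ≤ ‖applyMat D z‖ ^ 2 ∧ ‖applyMat D z‖ ^ 2 ≤ (1 + δ) * ‖z‖ ^ 2}

/-- The submatrix `D_T` made of the columns of `D` with index in `T`. -/
def cols {m N : ℕ} (D : Matrix (Fin m) (Fin N) ℝ) (T : Finset (Fin N)) :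
    Matrix (Fin m) T ℝ :=
  D.submatrix id Subtype.val

/-- The pseudo-inverse `A† = (Aᵀ A)⁻¹ Aᵀ` of a real matrix with linearly independent columns. (It is
only applied to such matrices: `D_S` with `|S| ≤ 2K`, where the restricted isometry constant of
order `3K` of `D` is less than one.) -/
def pinv {m : ℕ} {ι : Type} [Fintype ι] [DecidableEq ι] (A : Matrix (Fin m) ι ℝ) :
    Matrix ι (Fin m) ℝ :=
  (A.transpose * A)⁻¹ * A.transpose

/-- The vector whose entries on `T` are those of `D_T† y` and whose other entries are `0`. -/
def coeffOn {m N : ℕ} (D : Matrix (Fin m) (Fin N) ℝ) (T : Finset (Fin N))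
    (y : EuclideanSpace ℝ (Fin m)) : EuclideanSpace ℝ (Fin N) :=
  WithLp.toLp 2 fun i => if h : i ∈ T then (pinv (cols D T)).mulVec y.ofLp ⟨i, h⟩ else 0

/-- The residual `y - D_T D_T† y`. -/
def resid {m N : ℕ} (D : Matrix (Fin m) (Fin N) ℝ) (T : Finset (Fin N))
    (y : EuclideanSpace ℝ (Fin m)) : EuclideanSpace ℝ (Fin m) :=
  y - WithLp.toLp 2 ((cols D T).mulVec ((pinv (cols D T)).mulVec y.ofLp))

/-- The correlations `Dᵀ v`. -/
def corr {m N : ℕ} (D : Matrix (Fin m) (Fin N) ℝ) (v : EuclideanSpace ℝ (Fin m)) :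
    EuclideanSpace ℝ (Fin N) :=
  WithLp.toLp 2 (D.transpose.mulVec v.ofLp)

/-- `S` consists of the positions of `K` entries of largest magnitude of `v` among the positions in
`A`; ties may be broken in any way. -/
def IsLargest {N : ℕ} (K : ℕ) (A : Finset (Fin N)) (v : EuclideanSpace ℝ (Fin N))
    (S : Finset (Fin N)) : Prop :=
  S ⊆ A ∧ S.card = K ∧ ∀ i ∈ S, ∀ j ∈ A, j ∉ S → |v j| ≤ |v i|

/-- One iteration of Subspace Pursuit takes the support estimate `S` to `S'`: `K` positions of
largest correlation with the residual are added, `y` is represented over the enlarged support, and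
the `K` dominant entries of this representation are kept. -/
def Step {m N : ℕ} (K : ℕ) (D : Matrix (Fin m) (Fin N) ℝ) (y : EuclideanSpace ℝ (Fin m))
    (S S' : Finset (Fin N)) : Prop :=
  ∃ Δ : Finset (Fin N), IsLargest K Finset.univ (corr D (resid D S y)) Δ ∧
    IsLargest K (S ∪ Δ) (coeffOn D (S ∪ Δ) y) S'

/-- `IsSupport K D y ℓ S`: the set `S` is a possible support estimate of Subspace Pursuit after
`ℓ` iterations. -/
inductive IsSupport {m N : ℕ} (K : ℕ) (D : Matrix (Fin m) (Fin N) ℝ)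
    (y : EuclideanSpace ℝ (Fin m)) : ℕ → Finset (Fin N) → Prop
  | zero : IsSupport K D y 0 ∅
  | succ {ℓ : ℕ} {S S' : Finset (Fin N)} :
      IsSupport K D y ℓ S → Step K D y S S' → IsSupport K D y (ℓ + 1) S'

/-- `xhat` is a possible output of Subspace Pursuit, stopped after `ℓ` iterations. -/
def IsOutput {m N : ℕ} (K : ℕ) (D : Matrix (Fin m) (Fin N) ℝ) (y : EuclideanSpace ℝ (Fin m))
    (ℓ : ℕ) (xhat : EuclideanSpace ℝ (Fin N)) : Prop :=
  ∃ T : Finset (Fin N), IsSupport K D y ℓ T ∧ xhat = coeffOn D T y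

/-- `max_{|T| = K} ‖D_Tᵀ e‖₂`, that is, `‖D_{T_e}ᵀ e‖₂`. -/
def maxCorr {m N : ℕ} (K : ℕ) (D : Matrix (Fin m) (Fin N) ℝ)
    (e : EuclideanSpace ℝ (Fin m)) : ℝ :=
  ⨆ T : {T : Finset (Fin N) // T.card = K},
    ‖(WithLp.toLp 2 ((cols D T.1).transpose.mulVec e.ofLp) : EuclideanSpace ℝ T.1)‖

/-- The number of iterations `⌈log₂ (‖x‖₂ / ‖D_{T_e}ᵀ e‖₂)⌉` (zero if this is negative). -/
def numIter {m N : ℕ} (K : ℕ) (D : Matrix (Fin m) (Fin N) ℝ) (x : EuclideanSpace ℝ (Fin N))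
    (e : EuclideanSpace ℝ (Fin m)) : ℕ :=
  ⌈Real.logb 2 (‖x‖ / maxCorr K D e)⌉₊

/-- The constant `C_SP` as a function of `δ = δ_{3K}`. -/
def cSP (δ : ℝ) : ℝ :=
  2 * ((7 - 9 * δ + 7 * δ ^ 2 - δ ^ 3) / (1 - δ) ^ 4)

/-- `e` is a white Gaussian noise vector with variance `σ²`: its entries are independent centred
Gaussian random variables of variance `σ²`. -/
structure IsWhiteGaussian {Ω : Type*} [MeasurableSpace Ω] {m : ℕ}
    (e : Ω → EuclideanSpace ℝ (Fin m)) (σ : ℝ) (μ : Measure Ω) : Prop where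
  law : ∀ i, HasLaw (fun ω => e ω i) (gaussianReal 0 (σ ^ 2).toNNReal) μ
  indep : iIndepFun (fun i ω => e ω i) μ

end SubspacePursuit


end

open SubspacePursuit

/-! The noise matters only through M = `maxCorr K D e`. Each column is a unit vector, so its
correlation with e has law N(0, σ²). Mills' bound and a union bound over the N columns bound all
squared correlations by 2(1+a) log N · σ² with the required probability
(`IsWhiteGaussian.exists_event`), hence M² by K times that (`maxCorr_sq_le`).

The rest is deterministic. Let q(S) be the norm of x on the part of its support missed by S. Least
squares on S leaves an error of at most (q(S) + M)/(1 - δ) (`HasRIP.norm_sub_coeffOn_le`).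
Near-isometry on 3K coordinates makes large correlations find most of the missed mass, and pruning
loses little of it, so δ ≤ 0.139 gives q(S') ≤ q(S)/2 + cM for one iteration
(`HasRIP.norm_restr_sdiff_le_of_step`). Hence q ≤ ‖x‖/2^ℓ + 2cM after ℓ iterations. The choice of
`numIter` puts the first term below M, and a last least squares estimate yields `cSP δ` · M. -/

/-! ### Gaussian tails and sums -/

section GaussianTail

open Filter Topology

lemma gaussianPDFReal_zero_one (x : ℝ) :
    gaussianPDFReal 0 1 x = (√(2 * Real.pi))⁻¹ * Real.exp (-x ^ 2 / 2) := by
  simp [gaussianPDFReal]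

lemma hasDerivAt_gaussianPDFReal_zero_one (x : ℝ) :
    HasDerivAt (gaussianPDFReal 0 1) (-(x * gaussianPDFReal 0 1 x)) x := by
  have h : HasDerivAt (fun x : ℝ => (√(2 * Real.pi))⁻¹ * Real.exp (-x ^ 2 / 2))
      ((√(2 * Real.pi))⁻¹ * (Real.exp (-x ^ 2 / 2) * (-(2 * x) / 2))) x := by
    refine HasDerivAt.const_mul _ (HasDerivAt.exp ?_)
    simpa using ((hasDerivAt_pow 2 x).neg).div_const 2
  rw [show gaussianPDFReal 0 1 = fun x : ℝ => (√(2 * Real.pi))⁻¹ * Real.exp (-x ^ 2 / 2) from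
    funext gaussianPDFReal_zero_one]
  convert! h using 1
  ring

lemma tendsto_gaussianPDFReal_zero_one_atTop :
    Tendsto (gaussianPDFReal 0 1) atTop (𝓝 0) := by
  rw [show gaussianPDFReal 0 1 = fun x : ℝ => (√(2 * Real.pi))⁻¹ * Real.exp (-x ^ 2 / 2) from
    funext gaussianPDFReal_zero_one]
  rw [← mul_zero (√(2 * Real.pi))⁻¹]
  refine Tendsto.const_mul _ (Real.tendsto_exp_atBot.comp ?_)
  have h : Tendsto (fun x : ℝ => x ^ 2 / 2) atTop atTop :=
    (tendsto_pow_atTop two_ne_zero).atTop_div_const two_pos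
  exact (tendsto_neg_atTop_atBot.comp h).congr fun x => (neg_div _ _).symm

/-- The upper bound for Mills' ratio. -/
lemma setIntegral_gaussianPDFReal_Ioi_lt {t : ℝ} (ht : 0 < t) :
    ∫ x in Set.Ioi t, gaussianPDFReal 0 1 x < gaussianPDFReal 0 1 t / t := by
  -- Since φ' = -xφ, the integral of xφ over (t, ∞) is exactly φ(t). Replacing x by the smaller t
  -- loses a positive amount, so the bound is strict.
  have hneg : ∀ x ∈ Set.Ioi t, -(x * gaussianPDFReal 0 1 x) ≤ 0 := fun x hx =>
    neg_nonpos.2 (mul_nonneg (ht.trans hx).le (gaussianPDFReal_nonneg _ _ _))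
  have hint := integral_Ioi_of_hasDerivAt_of_nonpos'
    (fun x _ => hasDerivAt_gaussianPDFReal_zero_one x) hneg tendsto_gaussianPDFReal_zero_one_atTop
  have hI := integrableOn_Ioi_deriv_of_nonpos'
    (fun x _ => hasDerivAt_gaussianPDFReal_zero_one x) hneg tendsto_gaussianPDFReal_zero_one_atTop
  have hI1 : IntegrableOn (fun x => x * gaussianPDFReal 0 1 x) (Set.Ioi t) := by
    simpa using hI.neg
  have hI2 : IntegrableOn (gaussianPDFReal 0 1) (Set.Ioi t) :=
    (integrable_gaussianPDFReal 0 1).integrableOn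
  have hint1 : ∫ x in Set.Ioi t, x * gaussianPDFReal 0 1 x = gaussianPDFReal 0 1 t := by
    rw [integral_neg] at hint
    linarith
  have hdiff : IntegrableOn (fun x => x * gaussianPDFReal 0 1 x - t * gaussianPDFReal 0 1 x)
      (Set.Ioi t) := hI1.sub (hI2.const_mul t)
  have hpos : ∀ x ∈ Set.Ioi t, 0 < x * gaussianPDFReal 0 1 x - t * gaussianPDFReal 0 1 x := by
    intro x hx
    rw [← sub_mul]
    exact mul_pos (sub_pos.2 hx) (gaussianPDFReal_pos _ _ _ one_ne_zero)
  have key : 0 < ∫ x in Set.Ioi t, (x * gaussianPDFReal 0 1 x - t * gaussianPDFReal 0 1 x) := by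
    rw [setIntegral_pos_iff_support_of_nonneg_ae
      ((ae_restrict_iff' measurableSet_Ioi).2 (ae_of_all _ fun x hx => (hpos x hx).le)) hdiff]
    rw [Set.inter_eq_self_of_subset_right fun x hx => Function.mem_support.2 (hpos x hx).ne']
    simp
  rw [integral_sub hI1 (hI2.const_mul t), hint1, integral_const_mul] at key
  rw [lt_div_iff₀ ht]
  linarith

lemma gaussianReal_real_abs_gt_lt {t : ℝ} (ht : 0 < t) :
    (gaussianReal 0 1).real {x | t < |x|} < 2 * (gaussianPDFReal 0 1 t / t) := by
  have h1 : (gaussianReal 0 1).real (Set.Ioi t) = ∫ x in Set.Ioi t, gaussianPDFReal 0 1 x := by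
    rw [measureReal_def, gaussianReal_apply_eq_integral 0 one_ne_zero, ENNReal.toReal_ofReal]
    exact integral_nonneg fun x => gaussianPDFReal_nonneg _ _ _
  have h2 : (gaussianReal 0 1).real (Set.Iio (-t)) = (gaussianReal 0 1).real (Set.Ioi t) := by
    conv_lhs => rw [← neg_zero (G := ℝ), ← gaussianReal_map_neg]
    rw [map_measureReal_apply measurable_neg measurableSet_Iio]
    congr 1
    ext x
    simp
  have h3 : {x : ℝ | t < |x|} = Set.Ioi t ∪ Set.Iio (-t) := by
    ext x
    simp [lt_abs, lt_neg]
  have h4 := measureReal_union_le (μ := gaussianReal 0 1) (Set.Ioi t) (Set.Iio (-t))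
  have h5 := setIntegral_gaussianPDFReal_Ioi_lt ht
  rw [h3]
  linarith

/-- Linear combinations of independent centred Gaussian variables are Gaussian. -/
lemma hasLaw_sum_mul_gaussianReal {Ω ι : Type*} [MeasurableSpace Ω] {μ : Measure Ω}
    [IsProbabilityMeasure μ] {X : ι → Ω → ℝ} {v : NNReal}
    (hX : ∀ i, HasLaw (X i) (gaussianReal 0 v) μ) (hind : iIndepFun X μ) (c : ι → ℝ)
    (s : Finset ι) :
    HasLaw (fun ω => ∑ i ∈ s, c i * X i ω)
      (gaussianReal 0 (∑ i ∈ s, NNReal.mk (c i ^ 2) (sq_nonneg _) * v)) μ := by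
  classical
  have hc : ∀ i, HasLaw (fun ω => c i * X i ω)
      (gaussianReal 0 (NNReal.mk (c i ^ 2) (sq_nonneg _) * v)) μ := fun i => by
    simpa using gaussianReal_const_mul (hX i) (c i)
  have hind' : iIndepFun (fun i ω => c i * X i ω) μ :=
    hind.comp (fun i x => c i * x) fun i => measurable_const_mul _
  induction s using Finset.induction_on with
  | empty =>
    refine ⟨by simp, ?_⟩
    simp [Measure.map_const]
  | insert i s hi ih =>
    have hI := hind'.indepFun_finsetSum_of_notMem₀ (fun i => (hc i).aemeasurable) hi
    have hs : (∑ j ∈ s, fun ω => c j * X j ω) = fun ω => ∑ j ∈ s, c j * X j ω := by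
      ext ω
      simp
    rw [hs] at hI
    have := gaussianReal_add_gaussianReal_of_indepFun hI.symm (hc i).map_eq ih.map_eq
    simp only [Finset.sum_insert hi]
    refine ⟨(hc i).aemeasurable.add ih.aemeasurable, ?_⟩
    rw [zero_add] at this
    exact this

end GaussianTail

/-! ### The good event for the noise -/

namespace SubspacePursuit

/-- The noise has standard Gaussian correlation with each unit vector, up to the factor `σ`. -/
lemma IsWhiteGaussian.hasLaw_inner {Ω : Type*} [MeasurableSpace Ω] {μ : Measure Ω}
    [IsProbabilityMeasure μ] {m : ℕ} {e : Ω → EuclideanSpace ℝ (Fin m)} {σ : ℝ}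
    (he : IsWhiteGaussian e σ μ) (hσ : 0 < σ) {c : Fin m → ℝ} (hc : ∑ i, c i ^ 2 = 1) :
    HasLaw (fun ω => (∑ i, c i * e ω i) / σ) (gaussianReal 0 1) μ := by
  have h := gaussianReal_div_const
    (hasLaw_sum_mul_gaussianReal he.law he.indep c Finset.univ) σ
  convert h using 2
  · simp
  · apply NNReal.coe_injective
    rw [← Finset.sum_mul]
    push_cast
    simp [hc, hσ.ne', sq_nonneg]

/-- The second property costs no probability and makes `maxCorr` positive. Without it ‖x‖ / 0 = 0
would give `numIter` the value 0, and the iteration count would carry no information. -/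
lemma IsWhiteGaussian.exists_event {Ω : Type*} [MeasurableSpace Ω] {μ : Measure Ω}
    [IsProbabilityMeasure μ] {m N : ℕ} (hN : 2 ≤ N) {D : Matrix (Fin m) (Fin N) ℝ}
    (hD : ∀ j, ∑ i, D i j ^ 2 = 1) {e : Ω → EuclideanSpace ℝ (Fin m)} {σ : ℝ}
    (he : IsWhiteGaussian e σ μ) (hσ : 0 < σ) {a : ℝ} (ha : -1 < a) :
    ∃ E : Set Ω, MeasurableSet E ∧
      1 - (√(Real.pi * (1 + a) * Real.log N) * (N : ℝ) ^ a)⁻¹ < μ.real E ∧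
      ∀ ω ∈ E, (∀ j, (∑ i, D i j * e ω i) ^ 2 ≤ 2 * (1 + a) * Real.log N * σ ^ 2) ∧
        ∀ j, ∑ i, D i j * e ω i ≠ 0 := by
  have hN0 : (0 : ℝ) < N := by positivity
  have hlog : 0 < Real.log N := Real.log_pos (by exact_mod_cast hN)
  have ha1 : 0 < 1 + a := by linarith
  -- With this t, exp(-t²/2) = N^(-(1+a)); the union bound uses up one factor N.
  set t := √(2 * (1 + a) * Real.log N) with ht_def
  have ht : 0 < t := by positivity
  have ht2 : t ^ 2 = 2 * (1 + a) * Real.log N := Real.sq_sqrt (by positivity)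
  have law := fun j => he.hasLaw_inner hσ (hD j)
  let bad : Fin N → Set Ω := fun j => {ω | t < |(∑ i, D i j * e ω i) / σ|}
  let null : Fin N → Set Ω := fun j => {ω | (∑ i, D i j * e ω i) / σ = 0}
  have hbad : ∀ j, μ.real (bad j) < 2 * (gaussianPDFReal 0 1 t / t) := fun j => by
    have : μ.real (bad j) = _ := (law j).measureReal_eq (p := fun x => t < |x|)
      (measurableSet_lt measurable_const measurable_norm)
    rw [this]
    exact gaussianReal_real_abs_gt_lt ht
  have hnull : ∀ j, μ.real (null j) = 0 := fun j => by
    have h : μ.real (null j) = _ := (law j).measureReal_eq (p := fun x => x = 0)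
      (measurableSet_singleton 0)
    have := nullSingletonClass_gaussianReal (μ := 0) (v := 1) one_ne_zero
    rw [h, measureReal_def, Set.ofPred_eq_eq_singleton, measure_singleton, ENNReal.toReal_zero]
  have hone : ∀ j, μ.real (bad j ∪ null j) < 2 * (gaussianPDFReal 0 1 t / t) := fun j => by
    have := measureReal_union_le (μ := μ) (bad j) (null j)
    linarith [hbad j, hnull j]
  have hunion : μ.real (⋃ j, bad j ∪ null j) < N * (2 * (gaussianPDFReal 0 1 t / t)) := by
    have : Nonempty (Fin N) := ⟨⟨0, by omega⟩⟩
    calc μ.real (⋃ j, bad j ∪ null j) ≤ ∑ j, μ.real (bad j ∪ null j) :=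
          measureReal_iUnion_fintype_le _
      _ < ∑ _j : Fin N, 2 * (gaussianPDFReal 0 1 t / t) :=
          Finset.sum_lt_sum_of_nonempty Finset.univ_nonempty fun j _ => hone j
      _ = _ := by simp
  have hval : N * (2 * (gaussianPDFReal 0 1 t / t)) =
      (√(Real.pi * (1 + a) * Real.log N) * (N : ℝ) ^ a)⁻¹ := by
    have h1 : Real.exp (-t ^ 2 / 2) = ((N : ℝ) ^ a)⁻¹ * (N : ℝ)⁻¹ := by
      rw [ht2, show -(2 * (1 + a) * Real.log N) / 2 = -(Real.log N * (a + 1)) by ring, Real.exp_neg,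
        ← Real.rpow_def_of_pos hN0, Real.rpow_add hN0, Real.rpow_one, mul_inv]
    have h2 : √(2 * Real.pi) * t = 2 * √(Real.pi * (1 + a) * Real.log N) := by
      rw [ht_def, ← Real.sqrt_mul (by positivity),
        show 2 * Real.pi * (2 * (1 + a) * Real.log N) = 2 ^ 2 * (Real.pi * (1 + a) * Real.log N) by
          ring, Real.sqrt_mul (by positivity), Real.sqrt_sq (by norm_num)]
    rw [gaussianPDFReal_zero_one, h1]
    have h3 : (√(2 * Real.pi))⁻¹ * (((N : ℝ) ^ a)⁻¹ * (N : ℝ)⁻¹) / t =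
      (√(2 * Real.pi) * t)⁻¹ * (((N : ℝ) ^ a)⁻¹ * (N : ℝ)⁻¹) := by
        rw [mul_inv]; ring
    rw [h3, h2]
    have : (0 : ℝ) < N ^ a := by positivity
    field_simp
  -- The entries of e are only a.e. measurable, so the exceptional set is replaced by a measurable
  -- hull of equal measure.
  refine ⟨(toMeasurable μ (⋃ j, bad j ∪ null j))ᶜ, (measurableSet_toMeasurable _ _).compl, ?_, ?_⟩
  · rw [probReal_compl_eq_one_sub (measurableSet_toMeasurable _ _), measureReal_def,
      measure_toMeasurable, ← measureReal_def, ← hval]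
    linarith
  · intro ω hω
    have hω' : ∀ j, ω ∉ bad j ∪ null j := fun j hj =>
      hω (subset_toMeasurable _ _ (Set.mem_iUnion.2 ⟨j, hj⟩))
    refine ⟨fun j => ?_, fun j h0 => hω' j (Or.inr ?_)⟩
    · have h1 : ¬ t < |(∑ i, D i j * e ω i) / σ| := fun h => hω' j (Or.inl h)
      rw [not_lt, ← abs_of_pos ht, ← sq_le_sq, div_pow, div_le_iff₀ (by positivity), ht2] at h1
      exact h1
    · simp [null, h0]

/-! ### Restriction to sets of coordinates -/

section Restriction

variable {N : ℕ}

/-- The restriction of a vector to a set of coordinates. -/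
def restr (A : Finset (Fin N)) (v : EuclideanSpace ℝ (Fin N)) : EuclideanSpace ℝ (Fin N) :=
  WithLp.toLp 2 fun i => if i ∈ A then v i else 0

@[simp]
lemma restr_apply (A : Finset (Fin N)) (v : EuclideanSpace ℝ (Fin N)) (i : Fin N) :
    restr A v i = if i ∈ A then v i else 0 := rfl

lemma mem_supp {v : EuclideanSpace ℝ (Fin N)} {i : Fin N} : i ∈ supp v ↔ v i ≠ 0 := by
  simp [supp]

lemma supp_subset_iff {v : EuclideanSpace ℝ (Fin N)} {A : Finset (Fin N)} :
    supp v ⊆ A ↔ ∀ i ∉ A, v i = 0 := by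
  simp only [Finset.subset_iff, mem_supp]
  exact forall_congr' fun i => not_imp_comm

lemma supp_restr_subset (A : Finset (Fin N)) (v : EuclideanSpace ℝ (Fin N)) :
    supp (restr A v) ⊆ A :=
  supp_subset_iff.2 fun i hi => by simp [hi]

lemma inner_eq_sum (u v : EuclideanSpace ℝ (Fin N)) : inner ℝ u v = ∑ i, u i * v i := by
  simp [PiLp.inner_apply, mul_comm]

lemma inner_restr_left (A : Finset (Fin N)) (u v : EuclideanSpace ℝ (Fin N)) :
    inner ℝ (restr A u) v = ∑ i ∈ A, u i * v i := by
  simp [inner_eq_sum, Finset.sum_ite_mem, ite_mul]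

lemma norm_restr_sq (A : Finset (Fin N)) (v : EuclideanSpace ℝ (Fin N)) :
    ‖restr A v‖ ^ 2 = ∑ i ∈ A, v i ^ 2 := by
  simp [EuclideanSpace.real_norm_sq_eq, ite_pow, Finset.sum_ite_mem]

lemma inner_restr_self (A : Finset (Fin N)) (v : EuclideanSpace ℝ (Fin N)) :
    inner ℝ (restr A v) v = ‖restr A v‖ ^ 2 := by
  rw [inner_restr_left, norm_restr_sq]
  exact Finset.sum_congr rfl fun i _ => (sq _).symm

lemma norm_restr_mono {A B : Finset (Fin N)} (h : A ⊆ B) (v : EuclideanSpace ℝ (Fin N)) :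
    ‖restr A v‖ ≤ ‖restr B v‖ := by
  refine (sq_le_sq₀ (norm_nonneg _) (norm_nonneg _)).1 ?_
  rw [norm_restr_sq, norm_restr_sq]
  exact Finset.sum_le_sum_of_subset_of_nonneg h fun i _ _ => sq_nonneg _

lemma restr_congr {A : Finset (Fin N)} {u v : EuclideanSpace ℝ (Fin N)}
    (h : ∀ i ∈ A, u i = v i) : restr A u = restr A v := by
  ext i
  by_cases hi : i ∈ A <;> simp [hi, h]

lemma restr_eq_self {A : Finset (Fin N)} {v : EuclideanSpace ℝ (Fin N)} (h : supp v ⊆ A) :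
    restr A v = v := by
  ext i
  by_cases hi : i ∈ A
  · simp [hi]
  · simp [hi, supp_subset_iff.1 h i hi]

lemma norm_restr_le (A : Finset (Fin N)) (v : EuclideanSpace ℝ (Fin N)) : ‖restr A v‖ ≤ ‖v‖ := by
  simpa [restr_eq_self (Finset.subset_univ (supp v))] using
    norm_restr_mono (Finset.subset_univ A) v

lemma restr_add_restr_sdiff {A B : Finset (Fin N)} (v : EuclideanSpace ℝ (Fin N)) :
    restr A v + restr (B \ A) v = restr (A ∪ B) v := by
  ext i
  by_cases hA : i ∈ A <;> by_cases hB : i ∈ B <;> simp [hA, hB]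

end Restriction


/-- As |T| ≤ K = |S|, there are at least as many entries in S \ T as in (T ∩ A) \ S, and each of the
former dominates each of the latter. -/
lemma IsLargest.norm_restr_le {N K : ℕ} {A S T : Finset (Fin N)} {v : EuclideanSpace ℝ (Fin N)}
    (h : IsLargest K A v S) (hT : T.card ≤ K) :
    ‖restr ((T ∩ A) \ S) v‖ ≤ ‖restr (S \ T) v‖ := by
  obtain ⟨-, hcard, hmax⟩ := h
  refine (sq_le_sq₀ (norm_nonneg _) (norm_nonneg _)).1 ?_
  rw [norm_restr_sq, norm_restr_sq]
  have hle : ((T ∩ A) \ S).card ≤ (S \ T).card := by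
    have h1 : ((T ∩ A) \ S).card ≤ (T \ S).card :=
      Finset.card_le_card (Finset.sdiff_subset_sdiff Finset.inter_subset_left subset_rfl)
    have h2 := Finset.card_sdiff_add_card_inter T S
    have h3 := Finset.card_sdiff_add_card_inter S T
    rw [Finset.inter_comm] at h3
    omega
  rcases ((T ∩ A) \ S).eq_empty_or_nonempty with h0 | h0
  · rw [h0, Finset.sum_empty]
    exact Finset.sum_nonneg fun i _ => sq_nonneg _
  · obtain ⟨j, hj, hjmax⟩ := Finset.exists_max_image _ (fun i => v i ^ 2) h0
    have hj' := Finset.mem_sdiff.1 hj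
    calc ∑ i ∈ (T ∩ A) \ S, v i ^ 2 ≤ ((T ∩ A) \ S).card • v j ^ 2 :=
          Finset.sum_le_card_nsmul _ _ _ hjmax
      _ ≤ (S \ T).card • v j ^ 2 := nsmul_le_nsmul_left (sq_nonneg _) hle
      _ ≤ ∑ i ∈ S \ T, v i ^ 2 := Finset.card_nsmul_le_sum _ _ _ fun i hi =>
          sq_le_sq.2 (hmax i (Finset.mem_sdiff.1 hi).1 j (Finset.mem_inter.1 hj'.1).2 hj'.2)

/-! ### The matrix, its transpose and the noise level -/

section Operators

variable {m N : ℕ} (D : Matrix (Fin m) (Fin N) ℝ)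

lemma applyMat_add (u v : EuclideanSpace ℝ (Fin N)) :
    applyMat D (u + v) = applyMat D u + applyMat D v := by
  simp [applyMat, Matrix.mulVec_add]

lemma applyMat_sub (u v : EuclideanSpace ℝ (Fin N)) :
    applyMat D (u - v) = applyMat D u - applyMat D v := by
  simp [applyMat, Matrix.mulVec_sub]

lemma applyMat_smul (c : ℝ) (u : EuclideanSpace ℝ (Fin N)) :
    applyMat D (c • u) = c • applyMat D u := by
  simp [applyMat, Matrix.mulVec_smul]

lemma applyMat_zero : applyMat D 0 = 0 := by
  simp [applyMat]

lemma corr_apply (r : EuclideanSpace ℝ (Fin m)) (j : Fin N) :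
    corr D r j = ∑ i, D i j * r i := rfl

lemma inner_applyMat_left (u : EuclideanSpace ℝ (Fin N)) (r : EuclideanSpace ℝ (Fin m)) :
    inner ℝ (applyMat D u) r = inner ℝ u (corr D r) := by
  simp only [inner_eq_sum, corr_apply, applyMat, Matrix.mulVec, dotProduct, Finset.sum_mul,
    Finset.mul_sum]
  rw [Finset.sum_comm]
  exact Finset.sum_congr rfl fun i _ => Finset.sum_congr rfl fun j _ => by ring

/-- Extension by zero of a vector indexed by a set of coordinates. -/
def extend {N : ℕ} (T : Finset (Fin N)) (c : T → ℝ) : EuclideanSpace ℝ (Fin N) :=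
  WithLp.toLp 2 fun i => if h : i ∈ T then c ⟨i, h⟩ else 0

lemma extend_coe (T : Finset (Fin N)) (c : T → ℝ) (i : T) : extend T c i = c i := by
  simp [extend]

lemma supp_extend_subset (T : Finset (Fin N)) (c : T → ℝ) : supp (extend T c) ⊆ T :=
  supp_subset_iff.2 fun i hi => by simp [extend, hi]

lemma applyMat_extend (T : Finset (Fin N)) (c : T → ℝ) :
    applyMat D (extend T c) = WithLp.toLp 2 ((cols D T).mulVec c) := by
  ext k
  have h : ∑ i ∈ T, D k i * extend T c i = ∑ i, D k i * extend T c i :=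
    Finset.sum_subset (Finset.subset_univ T) fun i _ hi => by
      simp [supp_subset_iff.1 (supp_extend_subset T c) i hi]
  simp only [applyMat, Matrix.mulVec, dotProduct, cols, Matrix.submatrix_apply, id]
  rw [← h, ← Finset.sum_coe_sort]
  exact Finset.sum_congr rfl fun i _ => by rw [extend_coe]

lemma supp_coeffOn_subset (T : Finset (Fin N)) (y : EuclideanSpace ℝ (Fin m)) :
    supp (coeffOn D T y) ⊆ T :=
  supp_extend_subset T _

lemma resid_eq (T : Finset (Fin N)) (y : EuclideanSpace ℝ (Fin m)) :
    resid D T y = y - applyMat D (coeffOn D T y) := by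
  rw [resid, ← applyMat_extend]
  rfl

lemma maxCorr_eq (K : ℕ) (e : EuclideanSpace ℝ (Fin m)) :
    maxCorr K D e = ⨆ T : {T : Finset (Fin N) // T.card = K}, ‖restr T.1 (corr D e)‖ := by
  refine iSup_congr fun T => ?_
  rw [← sq_eq_sq₀ (norm_nonneg _) (norm_nonneg _), norm_restr_sq, EuclideanSpace.real_norm_sq_eq,
    ← Finset.sum_coe_sort T.1]
  rfl

variable {D}

lemma norm_restr_corr_le_maxCorr {K : ℕ} (hKN : K ≤ N) (e : EuclideanSpace ℝ (Fin m))
    {A : Finset (Fin N)} (hA : A.card ≤ K) : ‖restr A (corr D e)‖ ≤ maxCorr K D e := by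
  obtain ⟨T, hAT, hT⟩ := Finset.exists_superset_card_eq hA (by simpa using hKN)
  rw [maxCorr_eq]
  exact (norm_restr_mono hAT _).trans
    (le_ciSup (f := fun T : {T : Finset (Fin N) // T.card = K} => ‖restr T.1 (corr D e)‖)
      (Set.finite_range _).bddAbove ⟨T, hT⟩)

/-- Cauchy–Schwarz after moving D to the other side; the deterministic estimates use the noise only
in this form. -/
lemma abs_inner_applyMat_le_maxCorr {K : ℕ} (hKN : K ≤ N) (e : EuclideanSpace ℝ (Fin m))
    {A : Finset (Fin N)} (hA : A.card ≤ K) {v : EuclideanSpace ℝ (Fin N)} (hv : supp v ⊆ A) :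
    |inner ℝ (applyMat D v) e| ≤ maxCorr K D e * ‖v‖ := by
  have h : inner ℝ (applyMat D v) e = inner ℝ (restr A (corr D e)) v := by
    rw [inner_applyMat_left, ← restr_eq_self hv, inner_restr_left, inner_restr_left]
    exact Finset.sum_congr rfl fun i hi => by simp [hi, mul_comm]
  rw [h]
  exact (abs_real_inner_le_norm _ _).trans
    (mul_le_mul_of_nonneg_right (norm_restr_corr_le_maxCorr hKN e hA) (norm_nonneg _))

lemma maxCorr_sq_le {K : ℕ} (hKN : K ≤ N) {e : EuclideanSpace ℝ (Fin m)} {b : ℝ}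
    (hb : ∀ j, corr D e j ^ 2 ≤ b) : maxCorr K D e ^ 2 ≤ K * b := by
  obtain ⟨T, -, hT⟩ := Finset.exists_superset_card_eq (s := (∅ : Finset (Fin N))) (n := K)
    (by simp) (by simpa using hKN)
  have : Nonempty {T : Finset (Fin N) // T.card = K} := ⟨⟨T, hT⟩⟩
  obtain ⟨T', hT'⟩ := exists_eq_ciSup_of_finite
    (f := fun T : {T : Finset (Fin N) // T.card = K} => ‖restr T.1 (corr D e)‖)
  rw [maxCorr_eq, ← hT', norm_restr_sq, ← nsmul_eq_mul]
  have := Finset.sum_le_card_nsmul T'.1 _ b fun j _ => hb j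
  rwa [T'.2] at this

lemma maxCorr_pos {K : ℕ} (hK : 1 ≤ K) (hKN : K ≤ N) {e : EuclideanSpace ℝ (Fin m)} {j : Fin N}
    (hj : corr D e j ≠ 0) : 0 < maxCorr K D e := by
  refine lt_of_lt_of_le (norm_pos_iff.2 fun h => hj ?_)
    (norm_restr_corr_le_maxCorr hKN e (A := {j}) (by simpa using hK))
  simpa using congrArg (fun v : EuclideanSpace ℝ (Fin N) => v j) h

end Operators

/-! ### Restricted isometry and least squares -/

section RestrictedIsometry

variable {m N : ℕ} {D : Matrix (Fin m) (Fin N) ℝ}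

/-- `D` acts on `k`-sparse vectors as an isometry up to the factors `1 ± δ`. -/
def HasRIP (D : Matrix (Fin m) (Fin N) ℝ) (k : ℕ) (δ : ℝ) : Prop :=
  ∀ z : EuclideanSpace ℝ (Fin N), (supp z).card ≤ k →
    (1 - δ) * ‖z‖ ^ 2 ≤ ‖applyMat D z‖ ^ 2 ∧ ‖applyMat D z‖ ^ 2 ≤ (1 + δ) * ‖z‖ ^ 2

lemma exists_norm_applyMat_sq_le (D : Matrix (Fin m) (Fin N) ℝ) :
    ∃ c : ℝ, 0 ≤ c ∧ ∀ z, ‖applyMat D z‖ ^ 2 ≤ c * ‖z‖ ^ 2 := by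
  let L : EuclideanSpace ℝ (Fin N) →ₗ[ℝ] EuclideanSpace ℝ (Fin m) :=
    { toFun := applyMat D, map_add' := applyMat_add D, map_smul' := applyMat_smul D }
  refine ⟨‖LinearMap.toContinuousLinearMap L‖ ^ 2, sq_nonneg _, fun z => ?_⟩
  rw [← mul_pow]
  exact pow_le_pow_left₀ (norm_nonneg _) ((LinearMap.toContinuousLinearMap L).le_opNorm z) 2

lemma HasRIP.nonneg {k : ℕ} {δ : ℝ} (h : HasRIP D k δ) (hN : 0 < N) (hk : 1 ≤ k) : 0 ≤ δ := by
  let z : EuclideanSpace ℝ (Fin N) := EuclideanSpace.single ⟨0, hN⟩ 1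
  have hz : (supp z).card ≤ k := by
    have : supp z ⊆ {⟨0, hN⟩} := supp_subset_iff.2 fun i hi => by
      simp only [Finset.mem_singleton] at hi
      simp [z, hi]
    exact (Finset.card_le_card this).trans (by simpa using hk)
  obtain ⟨h1, h2⟩ := h z hz
  have h3 : ‖z‖ = 1 := by simp [z]
  rw [h3] at h1 h2
  linarith

/-- The infimum is attained: the admissible constants form a closed set, nonempty because D is
bounded and bounded below by 0. -/
lemma hasRIP_ripConst (hN : 0 < N) {k : ℕ} (hk : 1 ≤ k) : HasRIP D k (ripConst D k) := by
  have hbdd : BddBelow {δ : ℝ | HasRIP D k δ} := ⟨0, fun δ hδ => HasRIP.nonneg hδ hN hk⟩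
  have hne : {δ : ℝ | HasRIP D k δ}.Nonempty := by
    obtain ⟨c, hc, hcD⟩ := exists_norm_applyMat_sq_le D
    refine ⟨1 + c, fun z _ => ⟨?_, ?_⟩⟩
    · nlinarith [sq_nonneg ‖z‖, sq_nonneg ‖applyMat D z‖]
    · nlinarith [sq_nonneg ‖z‖, hcD z]
  have hclosed : IsClosed {δ : ℝ | HasRIP D k δ} := by
    simp only [HasRIP, Set.ofPred_forall, Set.ofPred_and]
    refine isClosed_iInter fun z => isClosed_iInter fun _ => IsClosed.inter ?_ ?_
    · exact isClosed_le (by fun_prop) (by fun_prop)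
    · exact isClosed_le (by fun_prop) (by fun_prop)
  exact hclosed.csInf_mem hne hbdd

variable {k : ℕ} {δ : ℝ}

/-- Polarisation, with u and v rescaled to equal norm: the upper bound for ‖v‖u + ‖u‖v minus the
lower bound for ‖v‖u - ‖u‖v. The supports may overlap. -/
lemma HasRIP.inner_le (h : HasRIP D k δ) {A : Finset (Fin N)} (hA : A.card ≤ k)
    {u v : EuclideanSpace ℝ (Fin N)} (hu : supp u ⊆ A) (hv : supp v ⊆ A) :
    inner ℝ (applyMat D u) (applyMat D v) ≤ inner ℝ u v + δ * ‖u‖ * ‖v‖ := by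
  rcases eq_or_ne u 0 with rfl | hu0
  · simp [applyMat_zero]
  rcases eq_or_ne v 0 with rfl | hv0
  · simp [applyMat_zero]
  have hp : 0 < ‖u‖ * ‖v‖ := mul_pos (norm_pos_iff.2 hu0) (norm_pos_iff.2 hv0)
  have hplus := (h (‖v‖ • u + ‖u‖ • v) ((Finset.card_le_card (supp_subset_iff.2 fun i hi => by
    simp [supp_subset_iff.1 hu i hi, supp_subset_iff.1 hv i hi])).trans hA)).2
  have hminus := (h (‖v‖ • u - ‖u‖ • v) ((Finset.card_le_card (supp_subset_iff.2 fun i hi => by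
    simp [supp_subset_iff.1 hu i hi, supp_subset_iff.1 hv i hi])).trans hA)).1
  rw [applyMat_add, applyMat_smul, applyMat_smul, norm_add_sq_real, norm_add_sq_real] at hplus
  rw [applyMat_sub, applyMat_smul, applyMat_smul, norm_sub_sq_real, norm_sub_sq_real] at hminus
  simp only [norm_smul, real_inner_smul_left, real_inner_smul_right, norm_norm] at hplus hminus
  refine le_of_mul_le_mul_left ?_ hp
  nlinarith [hplus, hminus]

lemma HasRIP.le_inner (h : HasRIP D k δ) {A : Finset (Fin N)} (hA : A.card ≤ k)
    {u v : EuclideanSpace ℝ (Fin N)} (hu : supp u ⊆ A) (hv : supp v ⊆ A) :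
    inner ℝ u v - δ * ‖u‖ * ‖v‖ ≤ inner ℝ (applyMat D u) (applyMat D v) := by
  have hneg : supp (-v) ⊆ A := supp_subset_iff.2 fun i hi => by
    simp [supp_subset_iff.1 hv i hi]
  have h1 := h.inner_le hA hu hneg
  have h2 : applyMat D (-v) = -applyMat D v := by
    simpa using applyMat_smul D (-1) v
  rw [h2, inner_neg_right, inner_neg_right, norm_neg] at h1
  linarith

/-- A kernel vector of the Gram matrix, extended by zero, is sparse and killed by D, so it is 0.
Thus `pinv` inverts a genuinely invertible matrix here. -/
lemma HasRIP.isUnit_gram (h : HasRIP D k δ) (hδ : δ < 1) {T : Finset (Fin N)}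
    (hT : T.card ≤ k) : IsUnit ((cols D T).transpose * cols D T) := by
  rw [← Matrix.mulVec_injective_iff_isUnit]
  intro c d hcd
  rw [← sub_eq_zero, ← Matrix.mulVec_sub] at hcd
  have h0 : (cols D T).mulVec (c - d) = 0 := by
    rw [← Matrix.conjTranspose_mul_self_mulVec_eq_zero]
    exact hcd
  have h1 := (h (extend T (c - d)) ((Finset.card_le_card (supp_extend_subset T _)).trans hT)).1
  rw [applyMat_extend, h0] at h1
  have h2 : ‖extend T (c - d)‖ = 0 := by
    simp only [WithLp.toLp_zero, norm_zero] at h1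
    have := sq_nonneg ‖extend T (c - d)‖
    exact pow_eq_zero_iff two_ne_zero |>.1 (by nlinarith)
  ext i
  have h3 := extend_coe T (c - d) i
  rw [norm_eq_zero.1 h2] at h3
  have h4 : (0 : ℝ) = c i - d i := h3
  linarith

/-- The normal equations: the residual is uncorrelated with the columns in `T`. -/
lemma HasRIP.corr_resid_eq_zero (h : HasRIP D k δ) (hδ : δ < 1) {T : Finset (Fin N)}
    (hT : T.card ≤ k) (y : EuclideanSpace ℝ (Fin m)) {j : Fin N} (hj : j ∈ T) :
    corr D (resid D T y) j = 0 := by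
  have hu := h.isUnit_gram hδ hT
  have h1 : (cols D T).transpose.mulVec (resid D T y).ofLp = 0 := by
    simp only [resid, pinv, WithLp.ofLp_sub, Matrix.mulVec_sub, Matrix.mulVec_mulVec]
    rw [← Matrix.mul_assoc, ← Matrix.mul_assoc, Matrix.mul_nonsing_inv _
      ((Matrix.isUnit_iff_isUnit_det _).1 hu), Matrix.one_mul, sub_self]
  exact congrFun h1 ⟨j, hj⟩

end RestrictedIsometry

/-! ### Deterministic analysis of the iteration -/

section Deterministic

variable {m N k K : ℕ} {D : Matrix (Fin m) (Fin N) ℝ} {δ M : ℝ}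

lemma norm_restr_union_le {N : ℕ} (A B : Finset (Fin N)) (v : EuclideanSpace ℝ (Fin N)) :
    ‖restr (A ∪ B) v‖ ≤ ‖restr A v‖ + ‖restr B v‖ := by
  rw [← restr_add_restr_sdiff]
  exact (norm_add_le _ _).trans
    (add_le_add le_rfl (norm_restr_mono Finset.sdiff_subset v))

lemma le_of_sq_le_mul {z c : ℝ} (hz : 0 ≤ z) (hc : 0 ≤ c) (h : z ^ 2 ≤ c * z) : z ≤ c := by
  rcases hz.eq_or_lt with rfl | hz
  · exact hc
  · rw [sq] at h
    exact le_of_mul_le_mul_right h hz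

/-- If the residual `D w + e` is uncorrelated with the columns in `A`, the part of `w` on `A` is
controlled by the part of `w` off `A` and the noise. -/
lemma HasRIP.norm_restr_le_of_corr_eq_zero (h : HasRIP D k δ) (hδ0 : 0 ≤ δ) (hM : 0 ≤ M)
    {A B : Finset (Fin N)} (hAB : Disjoint A B) (hk : (A ∪ B).card ≤ k)
    {w : EuclideanSpace ℝ (Fin N)} (hw : supp w ⊆ A ∪ B) (hδ1 : δ < 1)
    {e : EuclideanSpace ℝ (Fin m)}
    (he : ∀ v, supp v ⊆ A → |inner ℝ (applyMat D v) e| ≤ M * ‖v‖)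
    (horth : ∀ i ∈ A, corr D (applyMat D w + e) i = 0) :
    (1 - δ) * ‖restr A w‖ ≤ δ * ‖restr B w‖ + M := by
  set u := restr A w with hu_def
  set v := restr B w with hv_def
  have hu : supp u ⊆ A ∪ B := (supp_restr_subset A w).trans Finset.subset_union_left
  have hv : supp v ⊆ A ∪ B := (supp_restr_subset B w).trans Finset.subset_union_right
  have hsum : w = u + v := by
    rw [hu_def, hv_def, ← Finset.sdiff_eq_self_of_disjoint hAB.symm, restr_add_restr_sdiff,
      restr_eq_self hw]
  have h0 : inner ℝ (applyMat D u) (applyMat D w + e) = 0 := by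
    rw [inner_applyMat_left, hu_def, inner_restr_left]
    exact Finset.sum_eq_zero fun i hi => by rw [horth i hi, mul_zero]
  have huv : inner ℝ u v = 0 := by
    rw [hu_def, inner_restr_left]
    exact Finset.sum_eq_zero fun i hi => by
      simp [hv_def, Finset.disjoint_left.1 hAB hi]
  have h1 := h.le_inner hk hu hv
  have h2 := (h u ((Finset.card_le_card hu).trans hk)).1
  have h3 := he u (supp_restr_subset A w)
  rw [hsum, applyMat_add, inner_add_right, inner_add_right, real_inner_self_eq_norm_sq] at h0
  rw [huv] at h1
  have h4 := (abs_le.1 h3).1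
  refine le_of_sq_le_mul (mul_nonneg (by linarith) (norm_nonneg _)) (by positivity) ?_
  have h5 : (1 - δ) * ‖u‖ ^ 2 ≤ (δ * ‖v‖ + M) * ‖u‖ := by nlinarith
  calc ((1 - δ) * ‖u‖) ^ 2 = (1 - δ) * ((1 - δ) * ‖u‖ ^ 2) := by ring
    _ ≤ (1 - δ) * ((δ * ‖v‖ + M) * ‖u‖) := mul_le_mul_of_nonneg_left h5 (by linarith)
    _ = (δ * ‖v‖ + M) * ((1 - δ) * ‖u‖) := by ring

variable {x : EuclideanSpace ℝ (Fin N)} {e : EuclideanSpace ℝ (Fin m)}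

/-- This exhibits the residual as a noisy measurement of the current error. -/
lemma resid_eq_applyMat_sub (S : Finset (Fin N)) :
    resid D S (applyMat D x + e) =
      applyMat D (x - coeffOn D S (applyMat D x + e)) + e := by
  rw [resid_eq, applyMat_sub]
  abel

lemma supp_sub_coeffOn_subset (S : Finset (Fin N)) (y : EuclideanSpace ℝ (Fin m)) :
    supp (x - coeffOn D S y) ⊆ S ∪ (supp x \ S) := by
  refine supp_subset_iff.2 fun i hi => ?_
  rw [Finset.union_sdiff_self_eq_union, Finset.mem_union, not_or] at hi
  simp [supp_subset_iff.1 (supp_coeffOn_subset D S y) i hi.1,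
    supp_subset_iff.1 (subset_refl (supp x)) i hi.2]

lemma restr_sdiff_sub_coeffOn (S A : Finset (Fin N)) (y : EuclideanSpace ℝ (Fin m)) :
    restr (A \ S) (x - coeffOn D S y) = restr (A \ S) x :=
  restr_congr fun i hi => by
    simp [supp_subset_iff.1 (supp_coeffOn_subset D S y) i (Finset.mem_sdiff.1 hi).2]

lemma HasRIP.norm_restr_sub_coeffOn_le (h : HasRIP D k δ) (hδ0 : 0 ≤ δ) (hδ1 : δ < 1)
    (hM : 0 ≤ M) {S : Finset (Fin N)} (hk : (S ∪ supp x).card ≤ k)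
    (he : ∀ v, supp v ⊆ S → |inner ℝ (applyMat D v) e| ≤ M * ‖v‖) :
    (1 - δ) * ‖restr S (x - coeffOn D S (applyMat D x + e))‖ ≤
      δ * ‖restr (supp x \ S) x‖ + M := by
  have hSk : S.card ≤ k := (Finset.card_le_card Finset.subset_union_left).trans hk
  rw [← restr_sdiff_sub_coeffOn (D := D) S (supp x) (applyMat D x + e)]
  refine h.norm_restr_le_of_corr_eq_zero hδ0 hM Finset.disjoint_sdiff
    (by rwa [Finset.union_sdiff_self_eq_union]) (supp_sub_coeffOn_subset S _) hδ1 he fun i hi => ?_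
  rw [← resid_eq_applyMat_sub]
  exact h.corr_resid_eq_zero hδ1 hSk _ hi

/-- Off S the error is the missed part of x. The normal equations control it on S with factor δ, and
δ + (1 - δ) = 1. -/
lemma HasRIP.norm_sub_coeffOn_le (h : HasRIP D k δ) (hδ0 : 0 ≤ δ) (hδ1 : δ < 1)
    (hM : 0 ≤ M) {S : Finset (Fin N)} (hk : (S ∪ supp x).card ≤ k)
    (he : ∀ v, supp v ⊆ S → |inner ℝ (applyMat D v) e| ≤ M * ‖v‖) :
    (1 - δ) * ‖x - coeffOn D S (applyMat D x + e)‖ ≤ ‖restr (supp x \ S) x‖ + M := by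
  have h1 := h.norm_restr_sub_coeffOn_le hδ0 hδ1 hM hk he
  have h2 := norm_restr_union_le S (supp x \ S) (x - coeffOn D S (applyMat D x + e))
  rw [restr_eq_self (supp_sub_coeffOn_subset S _), restr_sdiff_sub_coeffOn] at h2
  nlinarith

/-- The coordinates of `x` missed after the enlargement of the support estimate. -/
lemma HasRIP.norm_restr_sdiff_union_le (h : HasRIP D k δ) (hδ0 : 0 ≤ δ) (hδ1 : δ < 1)
    (hM : 0 ≤ M) (hk : 3 * K ≤ k) (hx : (supp x).card ≤ K)
    (he : ∀ A : Finset (Fin N), A.card ≤ K → ∀ v, supp v ⊆ A →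
      |inner ℝ (applyMat D v) e| ≤ M * ‖v‖)
    {S Δ : Finset (Fin N)} (hS : S.card ≤ K)
    (hΔ : IsLargest K Finset.univ (corr D (resid D S (applyMat D x + e))) Δ) :
    (1 - δ) * ‖restr (supp x \ (S ∪ Δ)) x‖ ≤ 2 * δ * ‖restr (supp x \ S) x‖ + 2 * M := by
  set w := x - coeffOn D S (applyMat D x + e) with hw_def
  set g := corr D (resid D S (applyMat D x + e)) with hg_def
  set T := supp x with hT_def
  have hΔK : Δ.card = K := hΔ.2.1
  have hSTk : (S ∪ T).card ≤ k := (Finset.card_union_le _ _).trans (by omega)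
  have hr : resid D S (applyMat D x + e) = applyMat D w + e := resid_eq_applyMat_sub S
  have hgS : ∀ i ∈ S, g i = 0 := fun i hi =>
    h.corr_resid_eq_zero hδ1 ((Finset.card_le_card Finset.subset_union_left).trans hSTk) _ hi
  have hw : supp w ⊆ S ∪ T := by
    simpa [Finset.union_sdiff_self_eq_union] using
      supp_sub_coeffOn_subset (D := D) (x := x) S (applyMat D x + e)
  have hwle : (1 - δ) * ‖w‖ ≤ ‖restr (T \ S) x‖ + M :=
    h.norm_sub_coeffOn_le hδ0 hδ1 hM hSTk (he S hS)
  have hsel : ‖restr (T \ Δ) g‖ ≤ ‖restr (Δ \ T) g‖ := by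
    simpa using hΔ.norm_restr_le hx
  -- These three sets of at most K indices are the reason for the order 3K.
  set U := Δ ∪ (S ∪ T) with hU_def
  have hU : U.card ≤ k := by
    have h1 := Finset.card_union_le Δ (S ∪ T)
    have h2 := Finset.card_union_le S T
    rw [hU_def]
    omega
  have hwU : supp w ⊆ U := hw.trans Finset.subset_union_right
  -- Wrongly selected columns correlate weakly: g vanishes on S and w vanishes off S ∪ T, so z is
  -- orthogonal to w.
  have hz : ‖restr (Δ \ T) g‖ ≤ δ * ‖w‖ + M := by
    set z := restr (Δ \ T) g with hz_def
    have hzΔ : supp z ⊆ Δ := (supp_restr_subset _ _).trans Finset.sdiff_subset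
    have hzw : inner ℝ z w = 0 := by
      rw [hz_def, inner_restr_left]
      refine Finset.sum_eq_zero fun i hi => ?_
      by_cases hiS : i ∈ S
      · rw [hgS i hiS, zero_mul]
      · rw [supp_subset_iff.1 hw i (by simp [hiS, (Finset.mem_sdiff.1 hi).2]), mul_zero]
    have h1 : ‖z‖ ^ 2 = inner ℝ (applyMat D z) (applyMat D w) + inner ℝ (applyMat D z) e := by
      rw [← inner_add_right, ← hr, inner_applyMat_left, hz_def, inner_restr_self]
    have h2 := h.inner_le hU (hzΔ.trans Finset.subset_union_left) hwU
    have h3 := (abs_le.1 (he Δ hΔK.le z hzΔ)).2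
    refine le_of_sq_le_mul (norm_nonneg _) (by positivity) ?_
    rw [hzw] at h2
    linarith
  -- On the indices still missed, w equals x, so missed mass must show up in the correlations that
  -- were not selected.
  have hc : ‖restr (T \ (S ∪ Δ)) x‖ ≤ ‖restr (T \ Δ) g‖ + δ * ‖w‖ + M := by
    set c := restr (T \ (S ∪ Δ)) x with hc_def
    have hcT : supp c ⊆ T := (supp_restr_subset _ _).trans Finset.sdiff_subset
    have hcw : inner ℝ c w = ‖c‖ ^ 2 := by
      rw [hc_def, norm_restr_sq, inner_restr_left]
      refine Finset.sum_congr rfl fun i hi => ?_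
      have hiS : i ∉ S := fun hiS => (Finset.mem_sdiff.1 hi).2 (Finset.mem_union_left _ hiS)
      simp [hw_def, supp_subset_iff.1 (supp_coeffOn_subset D S (applyMat D x + e)) i hiS, sq]
    have hcg : inner ℝ c g = inner ℝ c (restr (T \ Δ) g) := by
      rw [hc_def, inner_restr_left, inner_restr_left]
      refine Finset.sum_congr rfl fun i hi => ?_
      have hi' := Finset.mem_sdiff.1 hi
      have hiΔ : i ∉ Δ := fun hiΔ => hi'.2 (Finset.mem_union_right _ hiΔ)
      simp [hi'.1, hiΔ]
    have h1 : inner ℝ c g =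
        inner ℝ (applyMat D c) (applyMat D w) + inner ℝ (applyMat D c) e := by
      rw [← inner_add_right, ← hr, inner_applyMat_left]
    have h2 := h.le_inner hU
      (hcT.trans (Finset.subset_union_right.trans Finset.subset_union_right)) hwU
    have h3 := (abs_le.1 (he T hx c hcT)).1
    have h4 := real_inner_le_norm c (restr (T \ Δ) g)
    refine le_of_sq_le_mul (norm_nonneg _) (by positivity) ?_
    rw [hcw] at h2
    linarith
  have h5 : ‖restr (T \ (S ∪ Δ)) x‖ ≤ 2 * (δ * ‖w‖ + M) := by linarith
  nlinarith [mul_le_mul_of_nonneg_left h5 (sub_nonneg.2 hδ1.le)]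

/-- The coordinates of `x` missed after the reduction of the support estimate. -/
lemma HasRIP.norm_restr_sdiff_le_of_isLargest (h : HasRIP D k δ) (hδ0 : 0 ≤ δ) (hδ1 : δ < 1)
    (hM : 0 ≤ M) (hx : (supp x).card ≤ K) {A S : Finset (Fin N)}
    (hk : (A ∪ supp x).card ≤ k)
    (he : ∀ v, supp v ⊆ A → |inner ℝ (applyMat D v) e| ≤ M * ‖v‖)
    (hS : IsLargest K A (coeffOn D A (applyMat D x + e)) S) :
    (1 - δ) * ‖restr (supp x \ S) x‖ ≤ (1 + δ) * ‖restr (supp x \ A) x‖ + 2 * M := by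
  set p := coeffOn D A (applyMat D x + e) with hp_def
  set T := supp x with hT_def
  have h1 : (1 - δ) * ‖restr A (x - p)‖ ≤ δ * ‖restr (T \ A) x‖ + M :=
    h.norm_restr_sub_coeffOn_le hδ0 hδ1 hM hk he
  have hsel := hS.norm_restr_le hx
  -- Outside its support x is 0, so the wrongly kept entries of p are pure error.
  have h2 : ‖restr (S \ T) p‖ ≤ ‖restr A (x - p)‖ := by
    have : restr (S \ T) p = -restr (S \ T) (x - p) := by
      ext i
      by_cases hi : i ∈ S \ T
      · simp only [restr_apply, hi, if_true, PiLp.neg_apply, PiLp.sub_apply]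
        rw [supp_subset_iff.1 (subset_refl T) i (Finset.mem_sdiff.1 hi).2]
        ring
      · simp [hi]
    rw [this, norm_neg]
    exact norm_restr_mono (Finset.sdiff_subset.trans hS.1) _
  have h3 : ‖restr ((T ∩ A) \ S) x‖ ≤ ‖restr A (x - p)‖ + ‖restr ((T ∩ A) \ S) p‖ := by
    have : restr ((T ∩ A) \ S) x = restr ((T ∩ A) \ S) (x - p) + restr ((T ∩ A) \ S) p := by
      ext i
      by_cases hi : i ∈ (T ∩ A) \ S <;> simp [hi]
    rw [this]
    exact (norm_add_le _ _).trans (add_le_add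
      (norm_restr_mono (Finset.sdiff_subset.trans Finset.inter_subset_right) _) le_rfl)
  have h4 : ‖restr (T \ S) x‖ ≤ ‖restr (T \ A) x‖ + ‖restr ((T ∩ A) \ S) x‖ := by
    refine (norm_restr_mono ?_ x).trans (norm_restr_union_le _ _ x)
    intro i hi
    have := Finset.mem_sdiff.1 hi
    by_cases hA : i ∈ A <;> simp [hA, this.1, this.2]
  -- The error on A counts twice: for the dropped entries of x, and for the wrong entries of p that
  -- displaced them.
  have h5 : ‖restr (T \ S) x‖ ≤ ‖restr (T \ A) x‖ + 2 * ‖restr A (x - p)‖ := by linarith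
  nlinarith [mul_le_mul_of_nonneg_left h5 (sub_nonneg.2 hδ1.le)]

/-- One iteration halves the missed part of `x`, up to a multiple of the noise level. -/
lemma HasRIP.norm_restr_sdiff_le_of_step (h : HasRIP D (3 * K) δ) (hδ0 : 0 ≤ δ) (hδ : δ ≤ 0.139)
    (hM : 0 ≤ M) (hx : (supp x).card ≤ K)
    (he : ∀ A : Finset (Fin N), A.card ≤ K → ∀ v, supp v ⊆ A →
      |inner ℝ (applyMat D v) e| ≤ M * ‖v‖)
    {S S' : Finset (Fin N)} (hS : S.card ≤ K) (hstep : Step K D (applyMat D x + e) S S') :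
    ‖restr (supp x \ S') x‖ ≤
      ‖restr (supp x \ S) x‖ / 2 + (6 - 6 * δ + 4 * δ ^ 2) / (1 - δ) ^ 3 * M := by
  obtain ⟨Δ, hΔ, hS'⟩ := hstep
  have hδ1 : δ < 1 := by linarith
  have hk : ((S ∪ Δ) ∪ supp x).card ≤ 3 * K := by
    have h1 := Finset.card_union_le (S ∪ Δ) (supp x)
    have h2 := Finset.card_union_le S Δ
    have h3 := hΔ.2.1
    omega
  -- The enlarged set can have 2K elements; splitting it into two blocks of at most K doubles the
  -- noise level.
  have he2 : ∀ v, supp v ⊆ S ∪ Δ → |inner ℝ (applyMat D v) e| ≤ 2 * M * ‖v‖ := by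
    intro v hv
    have h1 := he S hS (restr S v) (supp_restr_subset _ _)
    have h2 := he Δ hΔ.2.1.le (restr (Δ \ S) v)
      ((supp_restr_subset _ _).trans Finset.sdiff_subset)
    have h3 := norm_restr_le S v
    have h4 := norm_restr_le (Δ \ S) v
    rw [← restr_eq_self hv, ← restr_add_restr_sdiff, applyMat_add, inner_add_left,
      restr_add_restr_sdiff, restr_eq_self hv]
    calc _ ≤ _ := abs_add_le _ _
      _ ≤ M * ‖restr S v‖ + M * ‖restr (Δ \ S) v‖ := add_le_add h1 h2
      _ ≤ M * ‖v‖ + M * ‖v‖ := by gcongr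
      _ = 2 * M * ‖v‖ := by ring
  have h1 := h.norm_restr_sdiff_union_le hδ0 hδ1 hM le_rfl hx he hS hΔ
  have h2 := h.norm_restr_sdiff_le_of_isLargest hδ0 hδ1 (by positivity) hx hk he2 hS'
  set X := ‖restr (supp x \ S) x‖ with hX_def
  set C := ‖restr (supp x \ (S ∪ Δ)) x‖
  set X' := ‖restr (supp x \ S') x‖
  have hX : 0 ≤ X := norm_nonneg _
  have h1δ : 0 < 1 - δ := by linarith
  have h3 : (1 - δ) ^ 2 * X' ≤ 2 * δ * (1 + δ) * X + (6 - 2 * δ) * M := by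
    nlinarith [mul_le_mul_of_nonneg_left h2 h1δ.le,
      mul_le_mul_of_nonneg_left h1 (by linarith : (0 : ℝ) ≤ 1 + δ)]
  -- This gives the contraction factor 1/2. It amounts to 3δ² + 6δ ≤ 1, which 0.139 satisfies with
  -- room to spare.
  have h4 : 2 * δ * (1 + δ) ≤ (1 - δ) ^ 2 / 2 := by nlinarith
  -- The noise coefficient is weakened to the one that reproduces `cSP` exactly.
  have h5 : (1 - δ) * (6 - 2 * δ) ≤ 6 - 6 * δ + 4 * δ ^ 2 := by nlinarith
  have h6 : (6 - 2 * δ) ≤ (1 - δ) ^ 2 * ((6 - 6 * δ + 4 * δ ^ 2) / (1 - δ) ^ 3) := by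
    rw [show (1 - δ) ^ 2 * ((6 - 6 * δ + 4 * δ ^ 2) / (1 - δ) ^ 3) =
      (6 - 6 * δ + 4 * δ ^ 2) / (1 - δ) by field_simp, le_div_iff₀ h1δ]
    linarith
  refine le_of_mul_le_mul_left ?_ (pow_pos h1δ 2)
  nlinarith [mul_le_mul_of_nonneg_right h4 hX, mul_le_mul_of_nonneg_right h6 hM]

lemma IsSupport.card_le {y : EuclideanSpace ℝ (Fin m)} {ℓ : ℕ} {S : Finset (Fin N)}
    (h : IsSupport K D y ℓ S) : S.card ≤ K := by
  cases h with
  | zero => simp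
  | succ _ hstep =>
    obtain ⟨Δ, -, hS⟩ := hstep
    exact hS.2.1.le

/-- The value 2c is the fixed point of t ↦ t/2 + c, so the noise term does not grow with ℓ. -/
lemma HasRIP.norm_restr_sdiff_le_of_isSupport (h : HasRIP D (3 * K) δ) (hδ0 : 0 ≤ δ)
    (hδ : δ ≤ 0.139) (hM : 0 ≤ M) (hx : (supp x).card ≤ K)
    (he : ∀ A : Finset (Fin N), A.card ≤ K → ∀ v, supp v ⊆ A →
      |inner ℝ (applyMat D v) e| ≤ M * ‖v‖)
    {ℓ : ℕ} {S : Finset (Fin N)} (hS : IsSupport K D (applyMat D x + e) ℓ S) :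
    ‖restr (supp x \ S) x‖ ≤
      ‖x‖ / 2 ^ ℓ + 2 * ((6 - 6 * δ + 4 * δ ^ 2) / (1 - δ) ^ 3 * M) := by
  induction hS with
  | zero =>
    have h1 : 0 ≤ (6 - 6 * δ + 4 * δ ^ 2) / (1 - δ) ^ 3 * M :=
      mul_nonneg (div_nonneg (by nlinarith) (pow_nonneg (by linarith) 3)) hM
    have h2 := norm_restr_le (supp x \ ∅) x
    simp only [pow_zero, div_one]
    linarith
  | @succ ℓ S S' hS hstep ih =>
    have h1 := h.norm_restr_sdiff_le_of_step hδ0 hδ hM hx he hS.card_le hstep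
    rw [pow_succ, ← div_div]
    linarith

/-- The error of Subspace Pursuit in terms of the correlations of the noise. -/
lemma HasRIP.norm_sub_le_of_isOutput (h : HasRIP D (3 * K) δ) (hδ0 : 0 ≤ δ)
    (hδ : δ ≤ 0.139) (hKN : K ≤ N) (hx : (supp x).card ≤ K) (hM : 0 < maxCorr K D e)
    {ℓ : ℕ} (hℓ : numIter K D x e ≤ ℓ) {xhat : EuclideanSpace ℝ (Fin N)}
    (hxhat : IsOutput K D (applyMat D x + e) ℓ xhat) :
    ‖x - xhat‖ ≤ cSP δ * maxCorr K D e := by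
  obtain ⟨T, hT, rfl⟩ := hxhat
  set M := maxCorr K D e with hM_def
  have he : ∀ A : Finset (Fin N), A.card ≤ K → ∀ v, supp v ⊆ A →
      |inner ℝ (applyMat D v) e| ≤ M * ‖v‖ := fun A hA v hv =>
    abs_inner_applyMat_le_maxCorr hKN e hA hv
  have hiter : ‖x‖ / 2 ^ ℓ ≤ M := by
    rcases eq_or_ne x 0 with rfl | hx0
    · simpa using hM.le
    have hpos : 0 < ‖x‖ / M := div_pos (norm_pos_iff.2 hx0) hM
    have h1 : Real.logb 2 (‖x‖ / M) ≤ ℓ := Nat.ceil_le.1 hℓ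
    rw [Real.logb_le_iff_le_rpow one_lt_two hpos, Real.rpow_natCast, div_le_iff₀ hM] at h1
    rwa [div_le_iff₀ (by positivity), mul_comm]
  have h1 := h.norm_restr_sdiff_le_of_isSupport hδ0 hδ hM.le hx he hT
  have hk : (T ∪ supp x).card ≤ 3 * K := by
    have := Finset.card_union_le T (supp x)
    have := hT.card_le
    omega
  have h2 := h.norm_sub_coeffOn_le hδ0 (by linarith) hM.le hk (he T hT.card_le)
  have h1δ : 0 < 1 - δ := by linarith
  -- The summands are the bound for ‖x‖ / 2 ^ ℓ, the accumulated noise of the iterations, and the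
  -- noise of the final least squares fit.
  have h3 : (1 - δ) * (cSP δ * M) =
      M + 2 * ((6 - 6 * δ + 4 * δ ^ 2) / (1 - δ) ^ 3 * M) + M := by
    rw [cSP]
    field_simp
    ring
  refine le_of_mul_le_mul_left ?_ h1δ
  linarith

/-- The bound is nearly tight: the value at δ = 0.139 is about 21.405. -/
lemma cSP_le {δ : ℝ} (hδ : δ ≤ 0.139) : cSP δ ≤ 21.41 := by
  have h1 : (0.861 : ℝ) ^ 4 ≤ (1 - δ) ^ 4 := pow_le_pow_left₀ (by norm_num) (by linarith) 4
  have h2 : 2 * (7 - 9 * δ + 7 * δ ^ 2 - δ ^ 3) ≤ 21.41 * (1 - δ) ^ 4 := by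
    nlinarith
  rw [cSP, ← mul_div_assoc, div_le_iff₀ (by positivity)]
  exact h2

end Deterministic

end SubspacePursuit

/-! ### The deterministic bound on the good event -/

theorem mainTheorem1 {Ω : Type*} [MeasurableSpace Ω] (μ : Measure Ω) [IsProbabilityMeasure μ]
    {m N K : ℕ} (hN : 2 ≤ N) (hK : 1 ≤ K) (hKN : K ≤ N)
    (D : Matrix (Fin m) (Fin N) ℝ)
    (hD : ∀ j, ∑ i, D i j ^ 2 = 1)
    (hrip : ripConst D (3 * K) ≤ 0.139)
    (x : EuclideanSpace ℝ (Fin N)) (hx : (supp x).card ≤ K)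
    (σ : ℝ) (hσ : 0 < σ)
    (e : Ω → EuclideanSpace ℝ (Fin m)) (he : IsWhiteGaussian e σ μ)
    (a : ℝ) (ha : -1 < a) :
    cSP (ripConst D (3 * K)) ≤ 21.41 ∧
    ∃ E : Set Ω, MeasurableSet E ∧
      1 - (√(Real.pi * (1 + a) * Real.log N) * (N : ℝ) ^ a)⁻¹ < μ.real E ∧
      ∀ ω ∈ E, ∀ ℓ : ℕ, numIter K D x (e ω) ≤ ℓ →
        ∀ xhat : EuclideanSpace ℝ (Fin N), IsOutput K D (applyMat D x + e ω) ℓ xhat →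
          ‖x - xhat‖ ^ 2 ≤
            cSP (ripConst D (3 * K)) ^ 2 * (2 * (1 + a) * Real.log N) * K * σ ^ 2 := by
  have hR : HasRIP D (3 * K) (ripConst D (3 * K)) := hasRIP_ripConst (by omega) (by omega)
  have hδ0 : 0 ≤ ripConst D (3 * K) := hR.nonneg (by omega) (by omega)
  refine ⟨cSP_le hrip, ?_⟩
  obtain ⟨E, hE, hprob, hcorr⟩ := he.exists_event hN hD hσ ha
  refine ⟨E, hE, hprob, fun ω hω ℓ hℓ xhat hxhat => ?_⟩
  obtain ⟨hsmall, hne⟩ := hcorr ω hω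
  have hM := maxCorr_pos hK hKN (hne ⟨0, by omega⟩)
  have hM2 := maxCorr_sq_le hKN hsmall
  calc ‖x - xhat‖ ^ 2 ≤ (cSP (ripConst D (3 * K)) * maxCorr K D (e ω)) ^ 2 :=
        pow_le_pow_left₀ (norm_nonneg _)
          (hR.norm_sub_le_of_isOutput hδ0 hrip hKN hx hM hℓ hxhat) 2
    _ = cSP (ripConst D (3 * K)) ^ 2 * maxCorr K D (e ω) ^ 2 := mul_pow _ _ _
    _ ≤ cSP (ripConst D (3 * K)) ^ 2 * (K * (2 * (1 + a) * Real.log N * σ ^ 2)) :=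
        mul_le_mul_of_nonneg_left hM2 (sq_nonneg _)
    _ = _ := by ring
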